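/- For each $n$ let $X=(X_1,\dots,X_n)$ have independent coordinates $X_i\sim\mathcal N(\theta_i,1)$, and let $s=s_n\ge 1$ be integers. Consider estimation of $\|\theta\|_2^2=\sum_{i=1}^n\theta_i^2$ over the parameter space $$\Theta_n^2(s)=\Big\{\theta\in\mathbb R^n:\ \theta \text{ has at most } s \text{ non-zero components and } \|\theta\|_2^2\le 2s\log\Big(1+\frac{\sqrt n}{s}\Big)\Big\}.$$ An estimator is a sequence $T=(T_n)$ of measurable functions $T_n:\mathbb R^n\to\mathbb R$ of the data. The minimax risk is $R_n^*=\inf_{T_n}\sup_{\theta\in\Theta_n^2(s)}E_\theta[(T_n(X)-\|\theta\|_2^2)^2]$, the infimum being over all measurable $T_n$. For non-negative sequences, $a_n\lesssim b_n$ means that $a_n\le C b_n$ for some finite constant $C$ and all sufficiently large $n$, and $a_n\asymp b_n$ means $a_n\lesssim b_n\lesssim a_n$. An estimator is called minimax rate optimal if $\sup_{\theta\in\Theta_n^2(s)}E_\theta[(T_n(X)-\|\theta\|_2^2)^2]\lesssim R_n^*$. (i) If $s=o(\sqrt n)$ as $n\to\infty$, then $$R_n^*\asymp s^2\log^2\Big(\frac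 n{s^2}\Big),$$ and every minimax rate optimal estimator $T$ satisfies $$\sup_{\theta\in\Theta_n^2(s)}\big(E_\theta[T_n(X)]-\|\theta\|_2^2\big)^2\asymp s^2\log^2\Big(\frac n{s^2}\Big).$$ Moreover, if for some $0<\delta<1/2$ we have $s\le n^{1/2-\delta}$ for all sufficiently large $n$, then there exists a minimax rate optimal estimator $T$ with $$\sup_{\theta\in\Theta_n^2(s)}\operatorname{Var}_\theta(T_n(X))\lesssim s\log\Big(\frac n{s^2}\Big).$$ (ii) If $\sqrt n\lesssim s$, then there exists a minimax rate optimal estimator $T$ that is unbiased, that is, for every $n$ and every $\theta\in\Theta_n^2(s)$, $T_n(X)$ is integrable and $E_\theta[T_n(X)]=\|\theta\|_2^2$. -/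

import Mathlib

open MeasureTheory ProbabilityTheory Filter Asymptotics
open scoped ENNReal NNReal

noncomputable section

namespace GaussSeq

/-- The squared Euclidean norm `‖θ‖₂² = ∑ i, θ i ^ 2` of a vector of length `n`. -/
def sqNorm {n : ℕ} (θ : Fin n → ℝ) : ℝ := ∑ i, θ i ^ 2

/-- The Gaussian sequence model: the law of `X = (X₁, …, Xₙ)` with independent coordinates
`Xᵢ ∼ N(θᵢ, 1)`. -/
def law {n : ℕ} (θ : Fin n → ℝ) : Measure (Fin n → ℝ) :=
  Measure.pi fun i => gaussianReal (θ i) 1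

/-- The class `Θ(s)` of vectors with at most `s` non-zero components. -/
def sparse (n s : ℕ) : Set (Fin n → ℝ) :=
  {θ | {i | θ i ≠ 0}.ncard ≤ s}

/-- The parameter space `Θ_n²(s) = Θ(s) ∩ {θ : ∑ i, θ i ^ 2 ≤ 2 s log (1 + √n / s)}`. -/
def paramSpace (n s : ℕ) : Set (Fin n → ℝ) :=
  sparse n s ∩ {θ | sqNorm θ ≤ 2 * (s : ℝ) * Real.log (1 + √(n : ℝ) / (s : ℝ))}

/-- The mean squared error `E_θ[(T(X) - ‖θ‖₂²)²]`, possibly infinite, of an estimator `T`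
of `‖θ‖₂²`. -/
def mse {n : ℕ} (T : (Fin n → ℝ) → ℝ) (θ : Fin n → ℝ) : ℝ≥0∞ :=
  ∫⁻ x, ENNReal.ofReal ((T x - sqNorm θ) ^ 2) ∂(law θ)

/-- The worst-case risk `sup_θ E_θ[(T(X) - ‖θ‖₂²)²]` over `Θ_n²(s)`. -/
def worstRisk (n s : ℕ) (T : (Fin n → ℝ) → ℝ) : ℝ≥0∞ :=
  ⨆ θ ∈ paramSpace n s, mse T θ

/-- The worst-case squared bias `sup_θ (E_θ[T(X)] - ‖θ‖₂²)²` over `Θ_n²(s)`.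
It is meaningful when `T(X)` is integrable under each `θ` of the parameter space,
in particular when the worst-case risk of `T` is finite. -/
def worstSqBias (n s : ℕ) (T : (Fin n → ℝ) → ℝ) : ℝ≥0∞ :=
  ⨆ θ ∈ paramSpace n s, ENNReal.ofReal (((∫ x, T x ∂(law θ)) - sqNorm θ) ^ 2)

/-- The worst-case variance `sup_θ Var_θ(T(X))` over `Θ_n²(s)`, possibly infinite. -/
def worstVariance (n s : ℕ) (T : (Fin n → ℝ) → ℝ) : ℝ≥0∞ :=
  ⨆ θ ∈ paramSpace n s, eVar[T; law θ]

/-- The minimax risk for estimation of `‖θ‖₂²` over `Θ_n²(s)`: the infimum of the worst-case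
risk over all estimators, that is, all measurable functions of the data. -/
def minimaxMSE (n s : ℕ) : ℝ≥0∞ :=
  ⨅ (T : (Fin n → ℝ) → ℝ) (_ : Measurable T), worstRisk n s T

/-- `T(X)` is an unbiased estimator of `‖θ‖₂²` over `Θ_n²(s)`: its expectation exists and equals
`‖θ‖₂²` for every `θ` in the parameter space. -/
def IsUnbiased (n s : ℕ) (T : (Fin n → ℝ) → ℝ) : Prop :=
  ∀ θ ∈ paramSpace n s, Integrable T (law θ) ∧ ∫ x, T x ∂(law θ) = sqNorm θ

/-- `a ≲ b` for sequences in `[0, ∞]`: for some finite constant `C`, `a n ≤ C * b n` for all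
sufficiently large `n`. -/
def OrderLE (a b : ℕ → ℝ≥0∞) : Prop :=
  ∃ C : ℝ≥0, ∀ᶠ n in atTop, a n ≤ C * b n

/-- `a ≍ b` for sequences in `[0, ∞]`. -/
def SameOrder (a b : ℕ → ℝ≥0∞) : Prop := OrderLE a b ∧ OrderLE b a

/-- A sequence of estimators `T n` (measurable functions of the data in dimension `n`) attains
the minimax estimation rate for `‖θ‖₂²` over `Θ_n²(s n)`: its worst-case risk is of the order of
the minimax risk (it is never smaller). -/
def IsRateOptimal (s : ℕ → ℕ) (T : (n : ℕ) → (Fin n → ℝ) → ℝ) : Prop :=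
  (∀ n, Measurable (T n)) ∧
    OrderLE (fun n => worstRisk n (s n) (T n)) (fun n => minimaxMSE n (s n))

/-- The sequence `s² log²(n / s²)`. -/
def sparseRate (s : ℕ → ℕ) (n : ℕ) : ℝ≥0∞ :=
  ENNReal.ofReal ((s n : ℝ) ^ 2 * Real.log ((n : ℝ) / (s n : ℝ) ^ 2) ^ 2)

end GaussSeq

end

open GaussSeq

namespace GaussSeq

instance {n : ℕ} (θ : Fin n → ℝ) : IsProbabilityMeasure (law θ) := by
  unfold law; infer_instance

/-- The likelihood ratio of `N(a, 1)` with respect to `N(0, 1)`. -/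
noncomputable def lik (a x : ℝ) : ℝ := Real.exp (a * x - a ^ 2 / 2)

lemma lik_pos (a x : ℝ) : 0 < lik a x := Real.exp_pos _

lemma measurable_lik (a : ℝ) : Measurable (lik a) := by unfold lik; fun_prop

lemma lik_mul_lik (a b x : ℝ) : lik a x * lik b x = Real.exp (a * b) * lik (a + b) x := by
  simp only [lik, ← Real.exp_add]; congr 1; ring

lemma integrable_lik (a : ℝ) : Integrable (lik a) (gaussianReal 0 1) := by
  have := (integrable_exp_mul_gaussianReal (μ := 0) (v := 1) a).mul_const (Real.exp (-(a ^ 2 / 2)))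
  refine this.congr (ae_of_all _ fun x => ?_)
  simp only [lik, ← Real.exp_add]; congr 1

lemma integral_lik (a : ℝ) : ∫ x, lik a x ∂gaussianReal 0 1 = 1 := by
  have h : ∀ x, lik a x = Real.exp (a * x) * Real.exp (-(a ^ 2 / 2)) := fun x => by
    simp only [lik, ← Real.exp_add]; congr 1
  have h2 := congrFun (mgf_fun_id_gaussianReal (μ := 0) (v := 1)) a
  simp only [mgf] at h2
  simp only [h]
  rw [integral_mul_const, h2, ← Real.exp_add]
  simp

lemma gaussianReal_eq_withDensity (a : ℝ) :
    gaussianReal a 1 = (gaussianReal 0 1).withDensity fun x => ENNReal.ofReal (lik a x) := by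
  rw [gaussianReal_of_var_ne_zero _ one_ne_zero, gaussianReal_of_var_ne_zero _ one_ne_zero,
    ← withDensity_mul _ (measurable_gaussianPDF _ _) (measurable_lik a).ennreal_ofReal]
  congr 1
  ext1 x
  simp only [Pi.mul_apply, gaussianPDF, ← ENNReal.ofReal_mul (gaussianPDFReal_nonneg _ _ _)]
  congr 1
  simp only [gaussianPDFReal, lik, mul_assoc, ← Real.exp_add]
  congr 2
  simp; ring

/-- The likelihood ratio of `law θ` with respect to `law 0`. -/
noncomputable def likelihood {n : ℕ} (θ x : Fin n → ℝ) : ℝ := ∏ i, lik (θ i) (x i)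

lemma likelihood_nonneg {n : ℕ} (θ x : Fin n → ℝ) : 0 ≤ likelihood θ x :=
  Finset.prod_nonneg fun _ _ => (lik_pos _ _).le

lemma measurable_likelihood {n : ℕ} (θ : Fin n → ℝ) : Measurable (likelihood θ) := by
  unfold likelihood
  exact Finset.measurable_prod _ fun i _ => (measurable_lik _).comp (measurable_pi_apply i)

lemma law_eq_withDensity {n : ℕ} (θ : Fin n → ℝ) :
    law θ = (law 0).withDensity fun x => ENNReal.ofReal (likelihood θ x) := by
  unfold law
  refine Measure.pi_eq fun s hs => ?_
  rw [withDensity_apply _ (MeasurableSet.univ_pi hs), Measure.restrict_pi_pi]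
  unfold likelihood
  simp only [Pi.zero_apply]
  rw [← ofReal_integral_eq_lintegral_ofReal, integral_fintype_prod_eq_prod,
    ENNReal.ofReal_prod_of_nonneg]
  · refine Finset.prod_congr rfl fun i _ => ?_
    rw [ofReal_integral_eq_lintegral_ofReal (integrable_lik _).restrict
      (ae_of_all _ fun x => (lik_pos _ _).le), gaussianReal_eq_withDensity (θ i),
      withDensity_apply _ (hs i)]
  · exact fun i _ => integral_nonneg fun x => (lik_pos _ _).le
  · exact Integrable.fintype_prod fun _ => (integrable_lik _).restrict
  · exact ae_of_all _ fun x => likelihood_nonneg θ x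

lemma integral_law {n : ℕ} (θ : Fin n → ℝ) (T : (Fin n → ℝ) → ℝ) :
    ∫ x, T x ∂law θ = ∫ x, T x * likelihood θ x ∂law 0 := by
  rw [law_eq_withDensity θ, integral_withDensity_eq_integral_toReal_smul
    (measurable_likelihood θ).ennreal_ofReal (ae_of_all _ fun _ => ENNReal.ofReal_lt_top)]
  refine integral_congr_ae (ae_of_all _ fun x => ?_)
  simp [ENNReal.toReal_ofReal (likelihood_nonneg θ x), mul_comm]

lemma likelihood_mul {n : ℕ} (θ η x : Fin n → ℝ) :
    likelihood θ x * likelihood η x =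
      Real.exp (∑ i, θ i * η i) * likelihood (θ + η) x := by
  simp only [likelihood, Real.exp_sum, ← Finset.prod_mul_distrib, lik_mul_lik, Pi.add_apply]

lemma integrable_likelihood {n : ℕ} (θ : Fin n → ℝ) : Integrable (likelihood θ) (law 0) :=
  Integrable.fintype_prod fun _ => integrable_lik _

lemma integral_likelihood {n : ℕ} (θ : Fin n → ℝ) : ∫ x, likelihood θ x ∂law 0 = 1 := by
  unfold likelihood law
  rw [integral_fintype_prod_eq_prod]
  exact Finset.prod_eq_one fun i _ => integral_lik _

lemma integral_likelihood_mul {n : ℕ} (θ η : Fin n → ℝ) :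
    ∫ x, likelihood θ x * likelihood η x ∂law 0 = Real.exp (∑ i, θ i * η i) := by
  simp only [likelihood_mul]
  rw [integral_const_mul, integral_likelihood, mul_one]

lemma memLp_likelihood {n : ℕ} (θ : Fin n → ℝ) : MemLp (likelihood θ) 2 (law 0) := by
  rw [memLp_two_iff_integrable_sq (measurable_likelihood θ).aestronglyMeasurable]
  simp only [sq, likelihood_mul]
  exact (integrable_likelihood _).const_mul _

/-- The Cauchy-Schwarz inequality for square integrable random variables. -/
lemma abs_integral_mul_le_sqrt {α : Type*} {m : MeasurableSpace α} {μ : Measure α} {f g : α → ℝ}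
    (hf : MemLp f 2 μ) (hg : MemLp g 2 μ) :
    |∫ x, f x * g x ∂μ| ≤ √(∫ x, f x ^ 2 ∂μ) * √(∫ x, g x ^ 2 ∂μ) := by
  have hfg : Integrable (fun x => f x * g x) μ := hf.integrable_mul hg
  have key : ∀ t : ℝ, 0 ≤ (∫ x, f x ^ 2 ∂μ) * (t * t) + (-2 * ∫ x, f x * g x ∂μ) * t
      + ∫ x, g x ^ 2 ∂μ := fun t => by
    have h1 : 0 ≤ ∫ x, (t * f x - g x) ^ 2 ∂μ := integral_nonneg fun x => sq_nonneg _
    have h2 : ∀ x, (t * f x - g x) ^ 2 = t ^ 2 * f x ^ 2 - 2 * t * (f x * g x) + g x ^ 2 :=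
      fun x => by ring
    simp only [h2] at h1
    have i : Integrable (fun x => t ^ 2 * f x ^ 2 - 2 * t * (f x * g x)) μ :=
      (hf.integrable_sq.const_mul _).sub (hfg.const_mul _)
    rw [integral_add i hg.integrable_sq,
      integral_sub (hf.integrable_sq.const_mul _) (hfg.const_mul _), integral_const_mul,
      integral_const_mul] at h1
    linarith
  have hd := discrim_le_zero key
  rw [← Real.sqrt_mul (integral_nonneg fun x => sq_nonneg _)]
  apply Real.abs_le_sqrt
  simp only [discrim] at hd
  nlinarith

/-- The change of mean between `law 0` and a uniform mixture of the laws `law (θ k)` is controlled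
by the second moment under `law 0` and the chi-square divergence. -/
lemma abs_mean_mixture_sub_le {n : ℕ} {ι : Type*} [Fintype ι] [Nonempty ι] (θ : ι → Fin n → ℝ)
    {T : (Fin n → ℝ) → ℝ} (hT : MemLp T 2 (law 0)) :
    |(Fintype.card ι : ℝ)⁻¹ * ∑ k, ∫ x, T x ∂law (θ k) - ∫ x, T x ∂law 0| ≤
      √(∫ x, T x ^ 2 ∂law 0) *
      √(((Fintype.card ι : ℝ)⁻¹) ^ 2 * ∑ k, ∑ l, Real.exp (∑ i, θ k i * θ l i) - 1) := by
  set N := (Fintype.card ι : ℝ)⁻¹ with hN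
  have hNs : N * ∑ _k : ι, (1 : ℝ) = 1 := by simp [hN]
  let g : (Fin n → ℝ) → ℝ := fun x => N * ∑ k, likelihood (θ k) x
  have hg : MemLp g 2 (law 0) :=
    (memLp_finsetSum _ fun k _ => memLp_likelihood (θ k)).const_mul N
  have h1 : MemLp (fun _ : Fin n → ℝ => (1 : ℝ)) 2 (law 0) := memLp_const 1
  have hTL : ∀ k, Integrable (fun x => T x * likelihood (θ k) x) (law 0) := fun k =>
    hT.integrable_mul (memLp_likelihood _)
  have e1 : N * ∑ k, ∫ x, T x ∂law (θ k) - ∫ x, T x ∂law 0 = ∫ x, T x * (g x - 1) ∂law 0 := by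
    have : ∀ x, T x * (g x - 1) = N * ∑ k, T x * likelihood (θ k) x - T x := fun x => by
      simp only [g]; rw [← Finset.mul_sum]; ring
    simp only [this, integral_law (θ _)]
    rw [integral_sub ((integrable_finsetSum _ fun k _ => hTL k).const_mul _)
      (hT.integrable one_le_two), integral_const_mul, integral_finsetSum _ fun k _ => hTL k]
  have e2 : ∫ x, (g x - 1) ^ 2 ∂law 0 =
      N ^ 2 * ∑ k, ∑ l, Real.exp (∑ i, θ k i * θ l i) - 1 := by
    have hLL : ∀ k l, Integrable (fun x => likelihood (θ k) x * likelihood (θ l) x) (law 0) :=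
      fun k l => (memLp_likelihood _).integrable_mul (memLp_likelihood _)
    have : ∀ x, (g x - 1) ^ 2 = N ^ 2 * ∑ k, ∑ l, likelihood (θ k) x * likelihood (θ l) x
        - 2 * (N * ∑ k, likelihood (θ k) x) + 1 := fun x => by
      simp only [g]; rw [← Finset.sum_mul_sum]; ring
    simp only [this]
    have i1 : Integrable (fun x => N ^ 2 * ∑ k, ∑ l, likelihood (θ k) x * likelihood (θ l) x)
      (law 0) := (integrable_finsetSum _ fun k _ => integrable_finsetSum _ fun l _ =>
        hLL k l).const_mul _
    have i2 : Integrable (fun x => 2 * (N * ∑ k, likelihood (θ k) x)) (law 0) :=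
      ((integrable_finsetSum _ fun k _ => integrable_likelihood (θ k)).const_mul _).const_mul _
    have i3 : Integrable (fun x => N ^ 2 * ∑ k, ∑ l, likelihood (θ k) x * likelihood (θ l) x
        - 2 * (N * ∑ k, likelihood (θ k) x)) (law 0) := i1.sub i2
    rw [integral_add i3 (integrable_const _), integral_sub i1 i2, integral_const_mul,
      integral_const_mul, integral_const_mul,
      integral_finsetSum _ fun k _ => integrable_likelihood (θ k),
      integral_finsetSum _ fun k _ => integrable_finsetSum _ fun l _ => hLL k l]
    simp only [integral_finsetSum _ fun l _ => hLL _ l, integral_likelihood,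
      integral_likelihood_mul, hNs]
    simp; ring
  rw [e1, ← e2]
  exact abs_integral_mul_le_sqrt hT (hg.sub h1)

/-- The vector with entry `ρ` at the position `f j` of the `j`-th block, for every block `j`. -/
noncomputable def blockVec {n q m : ℕ} (e : Fin q × Fin m ↪ Fin n) (ρ : ℝ) (f : Fin q → Fin m) :
    Fin n → ℝ :=
  ∑ j, Pi.single (e (j, f j)) ρ

lemma sum_blockVec_mul {n q m : ℕ} (e : Fin q × Fin m ↪ Fin n) (ρ : ℝ) (f g : Fin q → Fin m) :
    ∑ i, blockVec e ρ f i * blockVec e ρ g i = ∑ j, if f j = g j then ρ ^ 2 else 0 := by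
  simp only [blockVec, Finset.sum_apply, Finset.sum_mul_sum, Pi.single_apply]
  rw [Finset.sum_comm]
  refine Finset.sum_congr rfl fun j _ => ?_
  rw [Finset.sum_comm, Finset.sum_eq_single j]
  · simp only [ite_mul, zero_mul, Finset.sum_ite_eq', Finset.mem_univ, if_true,
      EmbeddingLike.apply_eq_iff_eq, Prod.mk.injEq, true_and, mul_ite, mul_zero, sq,
      eq_comm]
  · intro k _ hk
    refine Finset.sum_eq_zero fun i _ => ?_
    by_cases h1 : i = e (j, f j)
    · rw [if_neg (c := i = e (k, g k)), mul_zero]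
      rw [h1, EmbeddingLike.apply_eq_iff_eq, Prod.mk.injEq]
      exact fun h => hk h.1.symm
    · rw [if_neg h1, zero_mul]
  · simp

lemma sqNorm_blockVec {n q m : ℕ} (e : Fin q × Fin m ↪ Fin n) (ρ : ℝ) (f : Fin q → Fin m) :
    sqNorm (blockVec e ρ f) = q * ρ ^ 2 := by
  have := sum_blockVec_mul e ρ f f
  simp only [sqNorm, sq] at this ⊢
  rw [this]; simp

lemma blockVec_mem_sparse {n q m : ℕ} (e : Fin q × Fin m ↪ Fin n) (ρ : ℝ) (f : Fin q → Fin m) :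
    blockVec e ρ f ∈ sparse n q := by
  have hsub : {i | blockVec e ρ f i ≠ 0} ⊆ Set.range fun j => e (j, f j) := by
    intro i hi
    by_contra h
    refine hi ?_
    simp only [blockVec, Finset.sum_apply]
    refine Finset.sum_eq_zero fun j _ => ?_
    rw [Pi.single_apply, if_neg]
    exact fun h' => h ⟨j, h'.symm⟩
  calc {i | blockVec e ρ f i ≠ 0}.ncard ≤ (Set.range fun j => e (j, f j)).ncard :=
        Set.ncard_le_ncard hsub (Set.toFinite _)
    _ ≤ (Set.univ : Set (Fin q)).ncard := by
        rw [← Set.image_univ]; exact Set.ncard_image_le (Set.toFinite _)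
    _ = q := by simp [Set.ncard_univ]

lemma sum_exp_blockVec {n q m : ℕ} (e : Fin q × Fin m ↪ Fin n) (ρ : ℝ) :
    ∑ f, ∑ g, Real.exp (∑ i, blockVec e ρ f i * blockVec e ρ g i) =
      ((m : ℝ) * (m - 1 + Real.exp (ρ ^ 2))) ^ q := by
  have h1 : ∀ a : Fin m, ∑ b : Fin m, Real.exp (if a = b then ρ ^ 2 else 0) =
      m - 1 + Real.exp (ρ ^ 2) := fun a => by
    have : ∀ b, Real.exp (if a = b then ρ ^ 2 else 0) =
        1 + if a = b then Real.exp (ρ ^ 2) - 1 else 0 := fun b => by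
      split_ifs <;> simp
    simp only [this, Finset.sum_add_distrib, Finset.sum_ite_eq, Finset.mem_univ, if_true]
    simp; ring
  have h2 : ∀ f : Fin q → Fin m, ∑ g : Fin q → Fin m,
      Real.exp (∑ i, blockVec e ρ f i * blockVec e ρ g i) = (m - 1 + Real.exp (ρ ^ 2)) ^ q :=
    fun f => by
      simp only [sum_blockVec_mul, Real.exp_sum]
      rw [← Fintype.piFinset_univ,
        ← Finset.prod_univ_sum (fun _ => Finset.univ)
          (fun j b => Real.exp (if f j = b then ρ ^ 2 else 0))]
      simp [h1]
  simp [h2, mul_pow]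

/-- Monotonicity of `t ↦ t log (1 + x / t)`. -/
lemma mul_log_one_add_div_le {x a b : ℝ} (hx : 0 ≤ x) (ha : 0 < a) (hab : a ≤ b) :
    a * Real.log (1 + x / a) ≤ b * Real.log (1 + x / b) := by
  have hb : 0 < b := ha.trans_le hab
  have hxa : 0 ≤ x / a := by positivity
  have h := rpow_one_add_le_one_add_mul_self (s := x / a) (by linarith)
    (p := a / b) (by positivity) (by rw [div_le_one hb]; exact hab)
  have h2 := Real.log_le_log (by positivity) h
  rw [Real.log_rpow (by positivity)] at h2
  have h3 : a / b * (x / a) = x / b := by field_simp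
  rw [h3] at h2
  calc a * Real.log (1 + x / a) = b * (a / b * Real.log (1 + x / a)) := by field_simp
    _ ≤ _ := by gcongr

lemma zero_mem_paramSpace (n s : ℕ) : (0 : Fin n → ℝ) ∈ paramSpace n s := by
  refine ⟨by simp [sparse], ?_⟩
  have : 0 ≤ Real.log (1 + √(n : ℝ) / (s : ℝ)) :=
    Real.log_nonneg (by have : 0 ≤ √(n : ℝ) / (s : ℝ) := by positivity
                        linarith)
  simp only [Set.mem_ofPred_eq, sqNorm, Pi.zero_apply]
  simp only [ne_eq, OfNat.ofNat_ne_zero, not_false_eq_true, zero_pow, Finset.sum_const_zero]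
  positivity

/-- The trade-off between the bias over the parameter space and the second moment at `0`. -/
theorem mul_log_le_bias_add_secondMoment {n q s : ℕ} (hq : 1 ≤ q) (hqn : (q : ℝ) ≤ √(n : ℝ))
    (hqs : q ≤ s) {T : (Fin n → ℝ) → ℝ} (hT : MemLp T 2 (law 0)) {B : ℝ}
    (hB : ∀ θ ∈ paramSpace n s, |∫ x, T x ∂law θ - sqNorm θ| ≤ B) :
    q * Real.log (1 + √(n : ℝ) / q) ≤
      2 * B + √(∫ x, T x ^ 2 ∂law 0) * √(Real.exp (2 * (q / √(n : ℝ))) - 1) := by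
  have hq0 : (0 : ℝ) < q := by exact_mod_cast hq
  have hn0 : 0 < √(n : ℝ) := hq0.trans_le hqn
  have hnn : √(n : ℝ) * √(n : ℝ) = n := Real.mul_self_sqrt (Nat.cast_nonneg n)
  set m := n / q with hm
  have hqn' : q ≤ n := by
    have h1 : (1 : ℝ) ≤ q := by exact_mod_cast hq
    have : (q : ℝ) ≤ n := by nlinarith
    exact_mod_cast this
  have hm1 : 1 ≤ m := (Nat.one_le_div_iff (by omega)).2 hqn'
  have hm0 : (0 : ℝ) < m := by exact_mod_cast hm1
  have hmn : (n : ℝ) ≤ 2 * q * m := by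
    have h1 : n < q * (m + 1) := by
      rw [mul_comm]; exact Nat.lt_mul_of_div_lt (by omega) (by omega)
    have h2 : n ≤ 2 * q * m := by nlinarith
    exact_mod_cast h2
  have hqm : q * m ≤ n := Nat.mul_div_le n q
  let e : Fin q × Fin m ↪ Fin n :=
    finProdFinEquiv.toEmbedding.trans (Fin.castLEEmb hqm)
  have hl0 : 0 ≤ Real.log (1 + √(n : ℝ) / q) :=
    Real.log_nonneg (by have : 0 ≤ √(n : ℝ) / q := by positivity
                        linarith)
  set ρ := √(Real.log (1 + √(n : ℝ) / q)) with hρ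
  have hρ2 : ρ ^ 2 = Real.log (1 + √(n : ℝ) / q) := Real.sq_sqrt hl0
  have hexp : Real.exp (ρ ^ 2) = 1 + √(n : ℝ) / q := by
    rw [hρ2, Real.exp_log (by positivity)]
  have hmem : ∀ f, blockVec e ρ f ∈ paramSpace n s := fun f => by
    refine ⟨(blockVec_mem_sparse e ρ f).trans hqs, ?_⟩
    have h1 := mul_log_one_add_div_le hn0.le hq0 (b := s) (by exact_mod_cast hqs)
    have h2 : 0 ≤ q * Real.log (1 + √(n : ℝ) / q) := by positivity
    simp only [Set.mem_ofPred_eq]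
    rw [sqNorm_blockVec, hρ2]
    linarith
  have : Nonempty (Fin m) := ⟨⟨0, hm1⟩⟩
  have key := abs_mean_mixture_sub_le (fun f : Fin q → Fin m => blockVec e ρ f) hT
  rw [sum_exp_blockVec] at key
  set N : ℝ := (Fintype.card (Fin q → Fin m) : ℝ)⁻¹ with hN
  have hNv : N = ((m : ℝ) ^ q)⁻¹ := by simp [hN]
  have hchi : N ^ 2 * ((m : ℝ) * (m - 1 + Real.exp (ρ ^ 2))) ^ q - 1 ≤
      Real.exp (2 * (q / √(n : ℝ))) - 1 := by
    have h1 : N ^ 2 * ((m : ℝ) * (m - 1 + Real.exp (ρ ^ 2))) ^ q =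
        (1 + √(n : ℝ) / q / m) ^ q := by
      rw [hNv, hexp, ← inv_pow, ← pow_mul, mul_comm q 2, pow_mul, ← mul_pow]
      congr 1
      field_simp
      ring
    rw [h1]
    have h2 : 1 + √(n : ℝ) / q / m ≤ Real.exp (√(n : ℝ) / q / m) := by
      linarith [Real.add_one_le_exp (√(n : ℝ) / q / m)]
    have h3 : (1 + √(n : ℝ) / q / m) ^ q ≤ Real.exp (√(n : ℝ) / q / m) ^ q :=
      pow_le_pow_left₀ (by positivity) h2 q
    rw [← Real.exp_nat_mul] at h3
    have h4 : (q : ℝ) * (√(n : ℝ) / q / m) ≤ 2 * (q / √(n : ℝ)) := by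
      have : (q : ℝ) * (√(n : ℝ) / q / m) = √(n : ℝ) / m := by field_simp
      rw [this, ← mul_div_assoc, div_le_div_iff₀ hm0 hn0, hnn]
      exact hmn
    linarith [Real.exp_le_exp.2 h4]
  have hav : N * ∑ f : Fin q → Fin m, sqNorm (blockVec e ρ f) = q * ρ ^ 2 := by
    simp only [sqNorm_blockVec]
    rw [Finset.sum_const, nsmul_eq_mul, ← mul_assoc, Finset.card_univ, hN,
      inv_mul_cancel₀ (by simp [hm0.ne']), one_mul]
  have hN0 : 0 ≤ N := by positivity
  have hbias : N * ∑ f : Fin q → Fin m, sqNorm (blockVec e ρ f) ≤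
      N * ∑ f : Fin q → Fin m, ∫ x, T x ∂law (blockVec e ρ f) + B := by
    have h1 : ∀ f : Fin q → Fin m, sqNorm (blockVec e ρ f) ≤
        ∫ x, T x ∂law (blockVec e ρ f) + B := fun f => by
      linarith [(abs_le.1 (hB _ (hmem f))).1]
    have h2 := Finset.sum_le_sum fun f (_ : f ∈ (Finset.univ : Finset (Fin q → Fin m))) => h1 f
    rw [Finset.sum_add_distrib, Finset.sum_const, nsmul_eq_mul, Finset.card_univ] at h2
    have h3 := mul_le_mul_of_nonneg_left h2 hN0
    rwa [mul_add, ← mul_assoc N _ B, hN,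
      inv_mul_cancel₀ (by simp [hm0.ne']), one_mul] at h3
  have h0 := (abs_le.1 (hB 0 (zero_mem_paramSpace n s))).2
  have hs0 : sqNorm (0 : Fin n → ℝ) = 0 := by simp [sqNorm]
  rw [hs0] at h0
  have hk := (abs_le.1 key).2
  have hmono : √(∫ x, T x ^ 2 ∂law 0) * √(N ^ 2 * ((m : ℝ) * (m - 1 + Real.exp (ρ ^ 2))) ^ q - 1)
      ≤ √(∫ x, T x ^ 2 ∂law 0) * √(Real.exp (2 * (q / √(n : ℝ))) - 1) := by
    gcongr
  rw [hav, hρ2] at hbias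
  linarith

lemma memLp_two_of_mse_ne_top {n : ℕ} {T : (Fin n → ℝ) → ℝ} (hT : Measurable T) {θ : Fin n → ℝ}
    (h : mse T θ ≠ ∞) : MemLp T 2 (law θ) := by
  have h1 : MemLp (fun x => T x - sqNorm θ) 2 (law θ) := by
    rw [memLp_two_iff_integrable_sq (by fun_prop)]
    refine ⟨by fun_prop, ?_⟩
    rw [hasFiniteIntegral_iff_ofReal (ae_of_all _ fun x => sq_nonneg _)]
    exact h.lt_top
  convert h1.add (memLp_const (sqNorm θ)) using 1
  ext x; simp

lemma mse_eq_ofReal {n : ℕ} {T : (Fin n → ℝ) → ℝ} {θ : Fin n → ℝ} (h : MemLp T 2 (law θ)) :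
    mse T θ = ENNReal.ofReal (∫ x, (T x - sqNorm θ) ^ 2 ∂law θ) := by
  rw [mse, ofReal_integral_eq_lintegral_ofReal _ (ae_of_all _ fun x => sq_nonneg _)]
  exact (h.sub (memLp_const (sqNorm θ))).integrable_sq

section Variance

variable {Ω : Type*} {m : MeasurableSpace Ω} {μ : Measure Ω} [IsProbabilityMeasure μ] {X : Ω → ℝ}

lemma variance_add_sq_eq (h : MemLp X 2 μ) (c : ℝ) :
    Var[X; μ] + (∫ x, X x ∂μ - c) ^ 2 = ∫ x, (X x - c) ^ 2 ∂μ := by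
  have h2 : ∀ x, (X x - c) ^ 2 = X x ^ 2 - 2 * c * X x + c ^ 2 := fun x => by ring
  have hX := h.integrable one_le_two
  have hi : Integrable (fun x => X x ^ 2 - 2 * c * X x) μ := h.integrable_sq.sub (hX.const_mul _)
  simp only [h2]
  rw [integral_add hi (integrable_const _), integral_sub h.integrable_sq (hX.const_mul _),
    integral_const_mul, variance_eq_sub h]
  simp only [integral_const, probReal_univ, smul_eq_mul, one_mul, Pi.pow_apply]
  ring

lemma variance_le_integral_sub_sq (h : MemLp X 2 μ) (c : ℝ) :
    Var[X; μ] ≤ ∫ x, (X x - c) ^ 2 ∂μ := by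
  linarith [variance_add_sq_eq h c, sq_nonneg (∫ x, X x ∂μ - c)]

lemma sq_integral_sub_le (h : MemLp X 2 μ) (c : ℝ) :
    (∫ x, X x ∂μ - c) ^ 2 ≤ ∫ x, (X x - c) ^ 2 ∂μ := by
  linarith [variance_add_sq_eq h c, variance_nonneg X μ]

end Variance

/-- The squared bias is at most the risk. -/
lemma ofReal_sq_bias_le_mse {n : ℕ} {T : (Fin n → ℝ) → ℝ} (hT : Measurable T) (θ : Fin n → ℝ) :
    ENNReal.ofReal ((∫ x, T x ∂law θ - sqNorm θ) ^ 2) ≤ mse T θ := by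
  by_cases h : mse T θ = ∞
  · simp [h]
  · have hL := memLp_two_of_mse_ne_top hT h
    rw [mse_eq_ofReal hL]
    exact ENNReal.ofReal_le_ofReal (sq_integral_sub_le hL _)

lemma worstSqBias_le_worstRisk {n s : ℕ} {T : (Fin n → ℝ) → ℝ} (hT : Measurable T) :
    worstSqBias n s T ≤ worstRisk n s T :=
  iSup₂_mono fun θ _ => ofReal_sq_bias_le_mse hT θ

/-- The trade-off between the worst squared bias and the worst risk. -/
theorem mul_log_le_sqrt_worstSqBias_add {n q s : ℕ} (hq : 1 ≤ q) (hqn : (q : ℝ) ≤ √(n : ℝ))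
    (hqs : q ≤ s) {T : (Fin n → ℝ) → ℝ} (hT : Measurable T) (hr : worstRisk n s T ≠ ∞) :
    q * Real.log (1 + √(n : ℝ) / q) ≤ 2 * √(worstSqBias n s T).toReal +
      √(worstRisk n s T).toReal * √(Real.exp (2 * (q / √(n : ℝ))) - 1) := by
  have hb : worstSqBias n s T ≠ ∞ := ne_top_of_le_ne_top hr (worstSqBias_le_worstRisk hT)
  have h0 : mse T 0 ≤ worstRisk n s T :=
    le_iSup₂_of_le (f := fun θ (_ : θ ∈ paramSpace n s) => mse T θ) 0
      (zero_mem_paramSpace n s) le_rfl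
  have hL : MemLp T 2 (law 0) := memLp_two_of_mse_ne_top hT (ne_top_of_le_ne_top hr h0)
  have hs0 : sqNorm (0 : Fin n → ℝ) = 0 := by simp [sqNorm]
  have hB : ∀ θ ∈ paramSpace n s, |∫ x, T x ∂law θ - sqNorm θ| ≤
      √(worstSqBias n s T).toReal := fun θ hθ => by
    apply Real.abs_le_sqrt
    rw [← ENNReal.ofReal_le_iff_le_toReal hb]
    exact le_iSup₂_of_le (f := fun θ (_ : θ ∈ paramSpace n s) =>
      ENNReal.ofReal ((∫ x, T x ∂law θ - sqNorm θ) ^ 2)) θ hθ le_rfl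
  refine (mul_log_le_bias_add_secondMoment hq hqn hqs hL hB).trans ?_
  gcongr
  rw [mse_eq_ofReal hL, ENNReal.ofReal_le_iff_le_toReal hr, hs0] at h0
  simpa using h0

/-- A lower bound for the minimax risk. -/
theorem ofReal_sq_mul_log_le_minimaxMSE {n q s : ℕ} (hq : 1 ≤ q) (hqn : (q : ℝ) ≤ √(n : ℝ))
    (hqs : q ≤ s) :
    ENNReal.ofReal ((q * Real.log (1 + √(n : ℝ) / q)) ^ 2) ≤ 36 * minimaxMSE n s := by
  have hn0 : 0 < √(n : ℝ) := lt_of_lt_of_le (by exact_mod_cast hq) hqn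
  unfold minimaxMSE
  rw [ENNReal.mul_iInf_of_ne (by norm_num) (by norm_num)]
  refine le_iInf fun T => ?_
  rw [ENNReal.mul_iInf_of_ne (by norm_num) (by norm_num)]
  refine le_iInf fun hT => ?_
  by_cases hr : worstRisk n s T = ∞
  · simp [hr]
  have key := mul_log_le_sqrt_worstSqBias_add hq hqn hqs hT hr
  have h1 : √(worstSqBias n s T).toReal ≤ √(worstRisk n s T).toReal :=
    Real.sqrt_le_sqrt (ENNReal.toReal_mono hr (worstSqBias_le_worstRisk hT))
  have h2 : √(Real.exp (2 * (q / √(n : ℝ))) - 1) ≤ 4 := by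
    apply Real.sqrt_le_iff.2 ⟨by norm_num, ?_⟩
    have h3 : (q : ℝ) / √(n : ℝ) ≤ 1 := (div_le_one hn0).2 hqn
    have h4 : Real.exp (2 * (q / √(n : ℝ))) ≤ Real.exp 1 * Real.exp 1 := by
      rw [← Real.exp_add]; apply Real.exp_le_exp.2; linarith
    nlinarith [Real.exp_one_lt_d9, Real.exp_pos 1]
  have hl0 : 0 ≤ Real.log (1 + √(n : ℝ) / q) :=
    Real.log_nonneg (by have : 0 ≤ √(n : ℝ) / q := by positivity
                        linarith)
  have h5 : q * Real.log (1 + √(n : ℝ) / q) ≤ 6 * √(worstRisk n s T).toReal := by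
    nlinarith [Real.sqrt_nonneg (worstRisk n s T).toReal]
  have h6 : (q * Real.log (1 + √(n : ℝ) / q)) ^ 2 ≤ 36 * (worstRisk n s T).toReal := by
    calc (q * Real.log (1 + √(n : ℝ) / q)) ^ 2 ≤ (6 * √(worstRisk n s T).toReal) ^ 2 :=
          pow_le_pow_left₀ (by positivity) h5 2
      _ = 36 * (worstRisk n s T).toReal := by
          rw [mul_pow, Real.sq_sqrt ENNReal.toReal_nonneg]; norm_num
  calc ENNReal.ofReal _ ≤ ENNReal.ofReal (36 * (worstRisk n s T).toReal) :=
        ENNReal.ofReal_le_ofReal h6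
    _ = 36 * worstRisk n s T := by
        rw [ENNReal.ofReal_mul (by norm_num), ENNReal.ofReal_toReal hr]; norm_num

/-- The fourth moment of the standard normal distribution. -/
noncomputable def fourthMoment : ℝ := ∫ x, x ^ 4 ∂gaussianReal 0 1

lemma fourthMoment_nonneg : 0 ≤ fourthMoment :=
  integral_nonneg fun x => by positivity

lemma memLp_sub_gaussianReal (a : ℝ) (p : ℝ≥0) :
    MemLp (fun x : ℝ => x - a) p (gaussianReal a 1) :=
  (memLp_id_gaussianReal (μ := a) (v := 1) p).sub (memLp_const a)

lemma integrable_pow_sub_gaussianReal (a : ℝ) (k : ℕ) :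
    Integrable (fun x : ℝ => (x - a) ^ k) (gaussianReal a 1) := by
  have h := (memLp_sub_gaussianReal a k).integrable_norm_pow'
  refine h.congr' (by fun_prop) (ae_of_all _ fun x => ?_)
  simp

lemma integral_sub_sq_gaussianReal (a : ℝ) : ∫ x, (x - a) ^ 2 ∂gaussianReal a 1 = 1 := by
  have h := variance_fun_id_gaussianReal (μ := a) (v := 1)
  rw [variance_eq_integral (by fun_prop)] at h
  simpa using h

lemma integral_sub_pow_four_gaussianReal (a : ℝ) :
    ∫ x, (x - a) ^ 4 ∂gaussianReal a 1 = fourthMoment := by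
  have h := gaussianReal_map_add_const (μ := 0) (v := 1) a
  rw [zero_add] at h
  rw [← h, integral_map (by fun_prop) (by fun_prop)]
  simp [fourthMoment]

lemma sq_sq_sub_sq_le (x a : ℝ) :
    (x ^ 2 - a ^ 2) ^ 2 ≤ 2 * (x - a) ^ 4 + 8 * a ^ 2 * (x - a) ^ 2 := by
  nlinarith [mul_nonneg (sq_nonneg (x - a)) (sq_nonneg (x - 3 * a))]

/-- A function that is `1`-Lipschitz in the square of its argument is square integrable for the
normal distribution, with an explicit second moment around its value at the mean. -/
lemma memLp_of_abs_sub_le {f : ℝ → ℝ} (hf : Measurable f) {a : ℝ}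
    (h : ∀ x, |f x - f a| ≤ |x ^ 2 - a ^ 2|) :
    MemLp f 2 (gaussianReal a 1) ∧
      ∫ x, (f x - f a) ^ 2 ∂gaussianReal a 1 ≤ 2 * fourthMoment + 8 * a ^ 2 := by
  have hb : ∀ x, (f x - f a) ^ 2 ≤ 2 * (x - a) ^ 4 + 8 * a ^ 2 * (x - a) ^ 2 := fun x =>
    (sq_le_sq.2 (h x)).trans (sq_sq_sub_sq_le x a)
  have hi : Integrable (fun x : ℝ => 2 * (x - a) ^ 4 + 8 * a ^ 2 * (x - a) ^ 2)
      (gaussianReal a 1) :=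
    ((integrable_pow_sub_gaussianReal a 4).const_mul _).add
      ((integrable_pow_sub_gaussianReal a 2).const_mul _)
  have hi2 : Integrable (fun x => (f x - f a) ^ 2) (gaussianReal a 1) :=
    hi.mono' (by fun_prop) (ae_of_all _ fun x => by
      rw [Real.norm_of_nonneg (sq_nonneg _)]; exact hb x)
  constructor
  · have h1 : MemLp (fun x => f x - f a) 2 (gaussianReal a 1) :=
      (memLp_two_iff_integrable_sq (by fun_prop)).2 hi2
    convert h1.add (memLp_const (f a)) using 1
    ext x; simp
  · calc _ ≤ ∫ x, (2 * (x - a) ^ 4 + 8 * a ^ 2 * (x - a) ^ 2) ∂gaussianReal a 1 :=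
          integral_mono hi2 hi hb
      _ = 2 * fourthMoment + 8 * a ^ 2 := by
          rw [integral_add ((integrable_pow_sub_gaussianReal a 4).const_mul _)
            ((integrable_pow_sub_gaussianReal a 2).const_mul _), integral_const_mul,
            integral_const_mul, integral_sub_sq_gaussianReal, integral_sub_pow_four_gaussianReal]
          ring

section Additive

variable {n : ℕ} {f : ℝ → ℝ} {θ : Fin n → ℝ}

lemma memLp_sum_comp_eval (hf : ∀ i, MemLp f 2 (gaussianReal (θ i) 1)) :
    MemLp (fun x : Fin n → ℝ => ∑ i, f (x i)) 2 (law θ) :=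
  memLp_finsetSum _ fun i _ => (hf i).comp_measurePreserving (measurePreserving_eval _ i)

lemma integral_sum_comp_eval (hf : ∀ i, MemLp f 2 (gaussianReal (θ i) 1)) :
    ∫ x, ∑ i, f (x i) ∂law θ = ∑ i, ∫ x, f x ∂gaussianReal (θ i) 1 := by
  rw [integral_finsetSum]
  · refine Finset.sum_congr rfl fun i _ => ?_
    exact integral_comp_eval (μ := fun i => gaussianReal (θ i) 1) (hf i).1
  · intro i _
    exact integrable_comp_eval (μ := fun i => gaussianReal (θ i) 1)
      ((hf i).integrable one_le_two)

lemma variance_sum_comp_eval (hf : ∀ i, MemLp f 2 (gaussianReal (θ i) 1)) :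
    Var[fun x : Fin n → ℝ => ∑ i, f (x i); law θ] = ∑ i, Var[f; gaussianReal (θ i) 1] := by
  have := variance_sum_pi (μ := fun i => gaussianReal (θ i) 1) (X := fun _ => f) hf
  rw [← this]
  congr 1
  ext x; simp

lemma mse_eq_variance_add_sq {T : (Fin n → ℝ) → ℝ} (h : MemLp T 2 (law θ)) :
    mse T θ = ENNReal.ofReal (Var[T; law θ] + (∫ x, T x ∂law θ - sqNorm θ) ^ 2) := by
  rw [mse_eq_ofReal h, variance_add_sq_eq h]

end Additive

/-- The unbiased estimator `∑ i, (X i ^ 2 - 1)` of the squared norm. -/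
def unbiasedEstimator (n : ℕ) (x : Fin n → ℝ) : ℝ := ∑ i, (x i ^ 2 - 1)

lemma measurable_unbiasedEstimator (n : ℕ) : Measurable (unbiasedEstimator n) := by
  unfold unbiasedEstimator; fun_prop

lemma memLp_sq_sub_one (a : ℝ) : MemLp (fun x : ℝ => x ^ 2 - 1) 2 (gaussianReal a 1) ∧
    ∫ x, ((x ^ 2 - 1) - (a ^ 2 - 1)) ^ 2 ∂gaussianReal a 1 ≤ 2 * fourthMoment + 8 * a ^ 2 :=
  memLp_of_abs_sub_le (f := fun x : ℝ => x ^ 2 - 1) (by fun_prop) fun x => by simp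

lemma integral_sq_sub_one (a : ℝ) : ∫ x, (x ^ 2 - 1) ∂gaussianReal a 1 = a ^ 2 := by
  have h : ∀ x : ℝ, x ^ 2 - 1 = (x - a) ^ 2 + (2 * a * x - a ^ 2 - 1) := fun x => by ring
  have i0 : Integrable (fun x : ℝ => 2 * a * x) (gaussianReal a 1) :=
    Integrable.const_mul (f := fun x : ℝ => x)
      ((memLp_id_gaussianReal (μ := a) (v := 1) 1).integrable (by simp)) (2 * a)
  have i1 : Integrable (fun x : ℝ => 2 * a * x - a ^ 2) (gaussianReal a 1) :=
    i0.sub (integrable_const _)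
  have i2 : Integrable (fun x : ℝ => 2 * a * x - a ^ 2 - 1) (gaussianReal a 1) :=
    i1.sub (integrable_const _)
  simp only [h]
  rw [integral_add (integrable_pow_sub_gaussianReal a 2) i2, integral_sub_sq_gaussianReal,
    integral_sub i1 (integrable_const _), integral_sub i0 (integrable_const _),
    integral_const_mul, integral_id_gaussianReal]
  simp; ring

lemma memLp_unbiasedEstimator {n : ℕ} (θ : Fin n → ℝ) :
    MemLp (unbiasedEstimator n) 2 (law θ) :=
  memLp_sum_comp_eval (f := fun x => x ^ 2 - 1) fun i => (memLp_sq_sub_one (θ i)).1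

lemma integral_unbiasedEstimator {n : ℕ} (θ : Fin n → ℝ) :
    ∫ x, unbiasedEstimator n x ∂law θ = sqNorm θ := by
  unfold unbiasedEstimator
  rw [integral_sum_comp_eval (f := fun x => x ^ 2 - 1) fun i => (memLp_sq_sub_one (θ i)).1]
  simp only [integral_sq_sub_one, sqNorm]

lemma isUnbiased_unbiasedEstimator (n s : ℕ) : IsUnbiased n s (unbiasedEstimator n) :=
  fun θ _ => ⟨(memLp_unbiasedEstimator θ).integrable one_le_two, integral_unbiasedEstimator θ⟩

lemma mse_unbiasedEstimator_le {n : ℕ} (θ : Fin n → ℝ) :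
    mse (unbiasedEstimator n) θ ≤ ENNReal.ofReal (2 * fourthMoment * n + 8 * sqNorm θ) := by
  rw [mse_eq_variance_add_sq (memLp_unbiasedEstimator θ), integral_unbiasedEstimator]
  apply ENNReal.ofReal_le_ofReal
  unfold unbiasedEstimator
  rw [variance_sum_comp_eval (f := fun x => x ^ 2 - 1) fun i => (memLp_sq_sub_one (θ i)).1]
  calc _ ≤ ∑ i, (2 * fourthMoment + 8 * θ i ^ 2) + (sqNorm θ - sqNorm θ) ^ 2 := by
        gcongr with i
        exact (variance_le_integral_sub_sq (memLp_sq_sub_one (θ i)).1 _).trans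
          (memLp_sq_sub_one (θ i)).2
    _ = _ := by
        rw [Finset.sum_add_distrib, Finset.sum_const, Finset.card_univ, Fintype.card_fin,
          nsmul_eq_mul, ← Finset.mul_sum, sqNorm]
        ring

/-- Soft thresholding of the square at level `t`. -/
def softSq (t x : ℝ) : ℝ := max (x ^ 2 - t) 0

lemma measurable_softSq (t : ℝ) : Measurable (softSq t) := by unfold softSq; fun_prop

lemma memLp_softSq (t a : ℝ) : MemLp (softSq t) 2 (gaussianReal a 1) ∧
    ∫ x, (softSq t x - softSq t a) ^ 2 ∂gaussianReal a 1 ≤ 2 * fourthMoment + 8 * a ^ 2 :=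
  memLp_of_abs_sub_le (measurable_softSq t) fun x => by
    have := abs_max_sub_max_le_abs (x ^ 2 - t) (a ^ 2 - t) 0
    simpa [softSq] using this

lemma softSq_le {t : ℝ} (ht : 0 ≤ t) (x : ℝ) : softSq t x ≤ x ^ 2 :=
  max_le (by linarith) (sq_nonneg x)

lemma softSq_nonneg (t x : ℝ) : 0 ≤ softSq t x := le_max_right _ _

lemma sq_softSq_le {τ : ℝ} (hτ : 0 ≤ τ) (x : ℝ) :
    softSq (τ ^ 2) x ^ 2 ≤
      24 * Real.exp (-τ ^ 2) * (Real.exp ((τ + 1) * x) + Real.exp (-(τ + 1) * x)) := by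
  by_cases h : x ^ 2 ≤ τ ^ 2
  · have : softSq (τ ^ 2) x = 0 := max_eq_right (by linarith)
    rw [this, zero_pow two_ne_zero]; positivity
  · push Not at h
    have hx : τ < |x| := by rw [← sq_abs x] at h; exact lt_of_pow_lt_pow_left₀ 2 (abs_nonneg x) h
    have h1 : softSq (τ ^ 2) x ^ 2 ≤ |x| ^ 4 := by
      have := pow_le_pow_left₀ (softSq_nonneg (τ ^ 2) x) (softSq_le (sq_nonneg τ) x) 2
      calc _ ≤ _ := this
        _ = |x| ^ 4 := by rw [← sq_abs x]; ring
    have h2 : |x| ^ 4 ≤ 24 * Real.exp |x| := by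
      have := Real.pow_div_factorial_le_exp |x| (abs_nonneg x) 4
      rw [div_le_iff₀ (by positivity)] at this
      norm_num [Nat.factorial] at this ⊢
      linarith
    have h3 : Real.exp |x| ≤ Real.exp (-τ ^ 2) * Real.exp ((τ + 1) * |x|) := by
      rw [← Real.exp_add]; apply Real.exp_le_exp.2; nlinarith
    have h4 : Real.exp ((τ + 1) * |x|) ≤ Real.exp ((τ + 1) * x) + Real.exp (-(τ + 1) * x) := by
      rcases abs_cases x with ⟨hx, _⟩ | ⟨hx, _⟩ <;> rw [hx]
      · linarith [Real.exp_pos (-(τ + 1) * x)]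
      · rw [mul_neg, ← neg_mul]; linarith [Real.exp_pos ((τ + 1) * x)]
    calc _ ≤ 24 * (Real.exp (-τ ^ 2) * Real.exp ((τ + 1) * |x|)) := by linarith
      _ ≤ 24 * (Real.exp (-τ ^ 2) * (Real.exp ((τ + 1) * x) + Real.exp (-(τ + 1) * x))) := by
          gcongr
      _ = _ := by ring

lemma integral_sq_softSq_le {τ : ℝ} (hτ : 0 ≤ τ) :
    ∫ x, softSq (τ ^ 2) x ^ 2 ∂gaussianReal 0 1 ≤
      48 * Real.exp (3 / 2) * Real.exp (-(τ ^ 2 / 4)) := by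
  have hm : ∀ u : ℝ, ∫ x, Real.exp (u * x) ∂gaussianReal 0 1 = Real.exp (u ^ 2 / 2) := fun u => by
    simpa [mgf] using congrFun (mgf_fun_id_gaussianReal (μ := 0) (v := 1)) u
  have i1 := integrable_exp_mul_gaussianReal (μ := 0) (v := 1) (τ + 1)
  have i2 := integrable_exp_mul_gaussianReal (μ := 0) (v := 1) (-(τ + 1))
  calc _ ≤ ∫ x, 24 * Real.exp (-τ ^ 2) * (Real.exp ((τ + 1) * x) + Real.exp (-(τ + 1) * x))
        ∂gaussianReal 0 1 := integral_mono (memLp_softSq _ 0).1.integrable_sq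
          ((i1.add i2).const_mul _) (sq_softSq_le hτ)
    _ = 48 * (Real.exp (-τ ^ 2) * Real.exp ((τ + 1) ^ 2 / 2)) := by
        rw [integral_const_mul, integral_add i1 i2, hm, hm, neg_sq]; ring
    _ ≤ 48 * (Real.exp (3 / 2) * Real.exp (-(τ ^ 2 / 4))) := by
        rw [← Real.exp_add, ← Real.exp_add]
        refine mul_le_mul_of_nonneg_left (Real.exp_le_exp.2 ?_) (by norm_num)
        nlinarith [sq_nonneg (τ - 2)]
    _ = _ := by ring

/-- The soft thresholding estimator of the squared norm, with threshold `8 log n` for the squared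
observations. -/
noncomputable def softEstimator (n : ℕ) (x : Fin n → ℝ) : ℝ := ∑ i, softSq (8 * Real.log n) (x i)

lemma measurable_softEstimator (n : ℕ) : Measurable (softEstimator n) := by
  unfold softEstimator
  exact Finset.measurable_sum _ fun i _ => (measurable_softSq _).comp (measurable_pi_apply i)

lemma memLp_softEstimator {n : ℕ} (θ : Fin n → ℝ) : MemLp (softEstimator n) 2 (law θ) :=
  memLp_sum_comp_eval fun i => (memLp_softSq _ (θ i)).1

lemma integral_sq_softSq_log_le {n : ℕ} (hn : 1 ≤ n) :
    ∫ x, softSq (8 * Real.log n) x ^ 2 ∂gaussianReal 0 1 ≤ 48 * Real.exp (3 / 2) / n ^ 2 := by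
  have hn0 : (0 : ℝ) < n := by exact_mod_cast hn
  have hl : 0 ≤ Real.log n := Real.log_natCast_nonneg n
  have h := integral_sq_softSq_le (Real.sqrt_nonneg (8 * Real.log n))
  rw [Real.sq_sqrt (by positivity)] at h
  have e : Real.exp (-(8 * Real.log n / 4)) = ((n : ℝ) ^ 2)⁻¹ := by
    rw [Real.exp_neg, ← Real.exp_log (pow_pos hn0 2), Real.log_pow]
    congr 2; push_cast; ring
  rw [e] at h
  exact h

lemma sum_indicator_le_of_sparse {n s : ℕ} {θ : Fin n → ℝ} (hθ : θ ∈ sparse n s) :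
    ∑ i, (if θ i = 0 then (0 : ℝ) else 1) ≤ s := by
  have h1 : ∑ i, (if θ i = 0 then (0 : ℝ) else 1) = {i | θ i ≠ 0}.ncard := by
    rw [Set.ncard_eq_toFinset_card']
    have h : ∀ i, (if θ i = 0 then (0 : ℝ) else 1) = if θ i ≠ 0 then 1 else 0 := fun i =>
      (ite_not _ _ _).symm
    simp only [h, Finset.sum_boole]
    congr 2
    ext i; simp
  rw [h1]
  exact_mod_cast hθ

lemma variance_softEstimator_le {n s : ℕ} {θ : Fin n → ℝ} (hθ : θ ∈ sparse n s) :
    Var[softEstimator n; law θ] ≤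
      48 * Real.exp (3 / 2) + 2 * fourthMoment * s + 8 * sqNorm θ := by
  have hK := fourthMoment_nonneg
  have hb : ∀ i, Var[softSq (8 * Real.log n); gaussianReal (θ i) 1] ≤
      48 * Real.exp (3 / 2) / n + 2 * fourthMoment * (if θ i = 0 then (0 : ℝ) else 1) +
        8 * θ i ^ 2 := fun i => by
    have hn : 1 ≤ n := i.pos
    have hn1 : (1 : ℝ) ≤ n := by exact_mod_cast hn
    split_ifs with h
    · rw [h]
      have h1 := variance_le_integral_sub_sq (memLp_softSq (8 * Real.log n) 0).1 0
      simp only [sub_zero] at h1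
      have h2 : 48 * Real.exp (3 / 2) / (n : ℝ) ^ 2 ≤ 48 * Real.exp (3 / 2) / n := by
        gcongr; nlinarith
      linarith [integral_sq_softSq_log_le hn]
    · have h1 := memLp_softSq (8 * Real.log n) (θ i)
      have h2 := variance_le_integral_sub_sq h1.1 (softSq (8 * Real.log n) (θ i))
      have h3 : 0 ≤ 48 * Real.exp (3 / 2) / (n : ℝ) := by positivity
      linarith [h1.2]
  have h1 : ∑ _i : Fin n, 48 * Real.exp (3 / 2) / (n : ℝ) ≤ 48 * Real.exp (3 / 2) := by
    rcases Nat.eq_zero_or_pos n with h | h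
    · subst h; simp; positivity
    · have : (n : ℝ) ≠ 0 := by exact_mod_cast h.ne'
      simp; field_simp; exact le_rfl
  unfold softEstimator
  rw [variance_sum_comp_eval fun i => (memLp_softSq _ (θ i)).1]
  refine (Finset.sum_le_sum fun i _ => hb i).trans ?_
  rw [Finset.sum_add_distrib, Finset.sum_add_distrib, ← Finset.mul_sum, ← Finset.mul_sum, sqNorm]
  have := mul_le_mul_of_nonneg_left (sum_indicator_le_of_sparse hθ)
    (show 0 ≤ 2 * fourthMoment by positivity)
  linarith

lemma abs_bias_softEstimator_le {n s : ℕ} {θ : Fin n → ℝ} (hθ : θ ∈ sparse n s) :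
    |∫ x, softEstimator n x ∂law θ - sqNorm θ| ≤
      48 * Real.exp (3 / 2) + (2 * fourthMoment + 1) * s + 9 * sqNorm θ := by
  have hK := fourthMoment_nonneg
  set K' : ℝ := 48 * Real.exp (3 / 2) with hK'
  have hK'1 : 1 ≤ K' := by
    have : 1 ≤ Real.exp (3 / 2) := Real.one_le_exp (by norm_num)
    linarith
  have hl : 0 ≤ 8 * Real.log n := by have := Real.log_natCast_nonneg n; positivity
  have hb : ∀ i, |∫ x, softSq (8 * Real.log n) x ∂gaussianReal (θ i) 1 - θ i ^ 2| ≤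
      K' / n + (2 * fourthMoment + 1) * (if θ i = 0 then (0 : ℝ) else 1) + 9 * θ i ^ 2 :=
    fun i => by
    have hn : 1 ≤ n := i.pos
    have hn1 : (1 : ℝ) ≤ n := by exact_mod_cast hn
    have hKn : 0 ≤ K' / n := by positivity
    have h0 := memLp_softSq (8 * Real.log n) (θ i)
    split_ifs with h
    · rw [h] at h0 ⊢
      have h1 := sq_integral_sub_le h0.1 0
      simp only [sub_zero] at h1
      have h2 := h1.trans (integral_sq_softSq_log_le hn)
      have h3 : |∫ x, softSq (8 * Real.log n) x ∂gaussianReal 0 1| ≤ K' / n := by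
        apply abs_le_of_sq_le_sq _ hKn
        refine h2.trans ?_
        rw [div_pow]
        gcongr
        nlinarith
      simpa using h3
    · have h1 := (sq_integral_sub_le h0.1 (softSq (8 * Real.log n) (θ i))).trans h0.2
      set m := ∫ x, softSq (8 * Real.log n) x ∂gaussianReal (θ i) 1
      set u := softSq (8 * Real.log n) (θ i) with hu
      have h2 : |m - u| ≤ 2 * fourthMoment + 1 + 8 * θ i ^ 2 := by
        nlinarith [sq_abs (m - u), sq_nonneg (|m - u| - 1), abs_nonneg (m - u), sq_nonneg (θ i)]
      have h3 : u ≤ θ i ^ 2 := softSq_le hl _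
      have h4 : 0 ≤ u := softSq_nonneg _ _
      rw [abs_le] at h2 ⊢
      constructor <;> linarith [h2.1, h2.2]
  have h1 : ∑ _i : Fin n, K' / (n : ℝ) ≤ K' := by
    rcases Nat.eq_zero_or_pos n with h | h
    · subst h; simp; positivity
    · have : (n : ℝ) ≠ 0 := by exact_mod_cast h.ne'
      simp; field_simp; exact le_rfl
  unfold softEstimator
  rw [integral_sum_comp_eval fun i => (memLp_softSq _ (θ i)).1, sqNorm, ← Finset.sum_sub_distrib]
  refine (Finset.abs_sum_le_sum_abs _ _).trans ((Finset.sum_le_sum fun i _ => hb i).trans ?_)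
  rw [Finset.sum_add_distrib, Finset.sum_add_distrib, ← Finset.mul_sum, ← Finset.mul_sum]
  have := mul_le_mul_of_nonneg_left (sum_indicator_le_of_sparse hθ)
    (show 0 ≤ 2 * fourthMoment + 1 by positivity)
  linarith

/-- Comparison of `log (1 + √n / s)` with `log (n / s²)`. -/
lemma log_one_add_sqrt_div_bounds {n s : ℕ} (hs : 1 ≤ s) (h : 2 * (s : ℝ) ≤ √(n : ℝ)) :
    Real.log ((n : ℝ) / (s : ℝ) ^ 2) / 2 ≤ Real.log (1 + √(n : ℝ) / s) ∧
      Real.log (1 + √(n : ℝ) / s) ≤ Real.log ((n : ℝ) / (s : ℝ) ^ 2) ∧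
      1 ≤ Real.log ((n : ℝ) / (s : ℝ) ^ 2) := by
  have hs0 : (0 : ℝ) < s := by exact_mod_cast hs
  set x := √(n : ℝ) / s with hx
  have hx2 : 2 ≤ x := by rw [hx, le_div_iff₀ hs0]; exact h
  have he : (n : ℝ) / (s : ℝ) ^ 2 = x ^ 2 := by
    rw [hx, div_pow, Real.sq_sqrt (Nat.cast_nonneg n)]
  have hlog : Real.log (x ^ 2) = 2 * Real.log x := by rw [Real.log_pow]; norm_num
  rw [he]
  refine ⟨?_, Real.log_le_log (by linarith) (by nlinarith), ?_⟩
  · rw [hlog]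
    linarith [Real.log_le_log (by linarith : 0 < x) (by linarith : x ≤ 1 + x)]
  · rw [hlog]
    linarith [Real.log_two_gt_d9, Real.log_le_log (by norm_num : (0 : ℝ) < 2) hx2]

lemma eventually_two_mul_le_sqrt {s : ℕ → ℕ}
    (h : (fun n => (s n : ℝ)) =o[atTop] fun n => √(n : ℝ)) :
    ∀ᶠ n in atTop, 2 * (s n : ℝ) ≤ √(n : ℝ) := by
  filter_upwards [h.bound (show (0 : ℝ) < 1 / 2 by norm_num)] with n hn
  rw [Real.norm_of_nonneg (by positivity), Real.norm_of_nonneg (by positivity)] at hn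
  linarith

lemma OrderLE.trans {a b c : ℕ → ℝ≥0∞} (h₁ : OrderLE a b) (h₂ : OrderLE b c) : OrderLE a c := by
  obtain ⟨C, hC⟩ := h₁
  obtain ⟨D, hD⟩ := h₂
  refine ⟨C * D, ?_⟩
  filter_upwards [hC, hD] with n h1 h2
  calc a n ≤ C * b n := h1
    _ ≤ C * (D * c n) := by gcongr
    _ = _ := by push_cast; ring

lemma OrderLE.of_le {a b : ℕ → ℝ≥0∞} (h : ∀ n, a n ≤ b n) : OrderLE a b :=
  ⟨1, Eventually.of_forall fun n => by simpa using h n⟩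

lemma OrderLE.of_ofReal {a : ℕ → ℝ≥0∞} {b : ℕ → ℝ} (C : ℝ) (hC : 0 ≤ C)
    (h : ∀ᶠ n in atTop, a n ≤ ENNReal.ofReal (C * b n)) :
    OrderLE a fun n => ENNReal.ofReal (b n) := by
  refine ⟨⟨C, hC⟩, ?_⟩
  filter_upwards [h] with n hn
  rwa [ENNReal.ofReal_mul hC, ENNReal.ofReal_eq_coe_nnreal hC] at hn

lemma minimaxMSE_le_worstRisk {n s : ℕ} {T : (Fin n → ℝ) → ℝ} (hT : Measurable T) :
    minimaxMSE n s ≤ worstRisk n s T :=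
  iInf₂_le T hT

section Sparse

variable {s : ℕ → ℕ}

/-- The minimax lower bound in the sparse regime. -/
theorem sparseRate_orderLE_minimaxMSE (hs : ∀ n, 1 ≤ s n)
    (h : (fun n => (s n : ℝ)) =o[atTop] fun n => √(n : ℝ)) :
    OrderLE (sparseRate s) fun n => minimaxMSE n (s n) := by
  refine ⟨4 * 36, ?_⟩
  filter_upwards [eventually_two_mul_le_sqrt h] with n hn
  obtain ⟨h1, -, h3⟩ := log_one_add_sqrt_div_bounds (hs n) hn
  have key := ofReal_sq_mul_log_le_minimaxMSE (n := n) (hs n) (by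
    have : (0 : ℝ) ≤ s n := Nat.cast_nonneg _
    linarith) le_rfl
  have h4 : (s n : ℝ) ^ 2 * Real.log ((n : ℝ) / (s n : ℝ) ^ 2) ^ 2 ≤
      4 * (s n * Real.log (1 + √(n : ℝ) / s n)) ^ 2 := by
    rw [mul_pow, mul_left_comm]
    gcongr
    nlinarith
  calc sparseRate s n ≤ ENNReal.ofReal (4 * (s n * Real.log (1 + √(n : ℝ) / s n)) ^ 2) :=
        ENNReal.ofReal_le_ofReal h4
    _ = 4 * ENNReal.ofReal ((s n * Real.log (1 + √(n : ℝ) / s n)) ^ 2) := by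
        rw [ENNReal.ofReal_mul (by norm_num)]; norm_num
    _ ≤ 4 * (36 * minimaxMSE n (s n)) := by gcongr
    _ = _ := by rw [← mul_assoc]; norm_num

/-- Risk and variance of the soft thresholding estimator in the sparse regime. -/
lemma softEstimator_bounds {n k : ℕ} (hk : 1 ≤ k) (hn : 2 * (k : ℝ) ≤ √(n : ℝ))
    {θ : Fin n → ℝ} (hθ : θ ∈ paramSpace n k) {M : ℝ}
    (hM : M = 48 * Real.exp (3 / 2) + 2 * fourthMoment + 19) :
    Var[softEstimator n; law θ] ≤ M * (k * Real.log ((n : ℝ) / (k : ℝ) ^ 2)) ∧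
    |∫ x, softEstimator n x ∂law θ - sqNorm θ| ≤ M * (k * Real.log ((n : ℝ) / (k : ℝ) ^ 2)) := by
  obtain ⟨-, h2, h3⟩ := log_one_add_sqrt_div_bounds hk hn
  have hk1 : (1 : ℝ) ≤ k := by exact_mod_cast hk
  have hK := fourthMoment_nonneg
  have hE := Real.exp_pos (3 / 2)
  set L := Real.log ((n : ℝ) / (k : ℝ) ^ 2)
  have hsq : sqNorm θ ≤ 2 * (k * L) := by
    refine hθ.2.trans ?_
    rw [mul_assoc]
    gcongr
  have hkL : (k : ℝ) ≤ k * L := le_mul_of_one_le_right (by linarith) h3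
  have e1 : 48 * Real.exp (3 / 2) ≤ 48 * Real.exp (3 / 2) * (k * L) :=
    le_mul_of_one_le_right (by positivity) (by linarith)
  have e2 : 2 * fourthMoment * k ≤ 2 * fourthMoment * (k * L) :=
    mul_le_mul_of_nonneg_left hkL (by positivity)
  rw [hM]
  constructor
  · linarith [variance_softEstimator_le hθ.1]
  · linarith [abs_bias_softEstimator_le hθ.1]

lemma worstRisk_softEstimator_orderLE (hs : ∀ n, 1 ≤ s n)
    (h : (fun n => (s n : ℝ)) =o[atTop] fun n => √(n : ℝ)) :
    OrderLE (fun n => worstRisk n (s n) (softEstimator n)) (sparseRate s) := by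
  have hK := fourthMoment_nonneg
  have hE := Real.exp_pos (3 / 2)
  obtain ⟨M, hM⟩ : ∃ M, M = 48 * Real.exp (3 / 2) + 2 * fourthMoment + 19 := ⟨_, rfl⟩
  have hM0 : 0 ≤ M := by rw [hM]; positivity
  refine OrderLE.of_ofReal (M + M ^ 2) (by positivity) ?_
  filter_upwards [eventually_two_mul_le_sqrt h] with n hn
  refine iSup₂_le fun θ hθ => ?_
  obtain ⟨hv, hb⟩ := softEstimator_bounds (hs n) hn hθ hM
  obtain ⟨-, -, h3⟩ := log_one_add_sqrt_div_bounds (hs n) hn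
  have hs1 : (1 : ℝ) ≤ s n := by exact_mod_cast hs n
  rw [mse_eq_variance_add_sq (memLp_softEstimator θ), ← mul_pow]
  apply ENNReal.ofReal_le_ofReal
  set R := (s n : ℝ) * Real.log ((n : ℝ) / (s n : ℝ) ^ 2)
  have hR : 1 ≤ R := one_le_mul_of_one_le_of_one_le hs1 h3
  have h4 := pow_le_pow_left₀ (abs_nonneg _) hb 2
  rw [sq_abs] at h4
  have h5 : M * R ≤ M * R ^ 2 := by gcongr; nlinarith
  linarith

/-- The minimax rate in the sparse regime. -/
theorem sameOrder_minimaxMSE_sparseRate (hs : ∀ n, 1 ≤ s n)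
    (h : (fun n => (s n : ℝ)) =o[atTop] fun n => √(n : ℝ)) :
    SameOrder (fun n => minimaxMSE n (s n)) (sparseRate s) :=
  ⟨(OrderLE.of_le fun n => minimaxMSE_le_worstRisk (measurable_softEstimator n)).trans
    (worstRisk_softEstimator_orderLE hs h), sparseRate_orderLE_minimaxMSE hs h⟩

lemma isRateOptimal_softEstimator (hs : ∀ n, 1 ≤ s n)
    (h : (fun n => (s n : ℝ)) =o[atTop] fun n => √(n : ℝ)) :
    IsRateOptimal s softEstimator :=
  ⟨measurable_softEstimator,
    (worstRisk_softEstimator_orderLE hs h).trans (sparseRate_orderLE_minimaxMSE hs h)⟩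

lemma worstVariance_softEstimator_orderLE (hs : ∀ n, 1 ≤ s n)
    (h : (fun n => (s n : ℝ)) =o[atTop] fun n => √(n : ℝ)) :
    OrderLE (fun n => worstVariance n (s n) (softEstimator n))
      fun n => ENNReal.ofReal ((s n : ℝ) * Real.log ((n : ℝ) / (s n : ℝ) ^ 2)) := by
  have hK := fourthMoment_nonneg
  have hE := Real.exp_pos (3 / 2)
  obtain ⟨M, hM⟩ : ∃ M, M = 48 * Real.exp (3 / 2) + 2 * fourthMoment + 19 := ⟨_, rfl⟩
  refine OrderLE.of_ofReal M (by rw [hM]; positivity) ?_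
  filter_upwards [eventually_two_mul_le_sqrt h] with n hn
  refine iSup₂_le fun θ hθ => ?_
  rw [← ofReal_variance (memLp_softEstimator θ)]
  exact ENNReal.ofReal_le_ofReal (softEstimator_bounds (hs n) hn hθ hM).1

/-- In the sparse regime the squared bias of a rate optimal estimator is of the order of its
risk. -/
theorem sameOrder_worstSqBias_sparseRate (hs : ∀ n, 1 ≤ s n)
    (h : (fun n => (s n : ℝ)) =o[atTop] fun n => √(n : ℝ))
    {T : (n : ℕ) → (Fin n → ℝ) → ℝ} (hT : IsRateOptimal s T) :
    SameOrder (fun n => worstSqBias n (s n) (T n)) (sparseRate s) := by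
  have hrisk : OrderLE (fun n => worstRisk n (s n) (T n)) (sparseRate s) :=
    hT.2.trans (sameOrder_minimaxMSE_sparseRate hs h).1
  refine ⟨(OrderLE.of_le fun n => worstSqBias_le_worstRisk (hT.1 n)).trans hrisk, 64, ?_⟩
  obtain ⟨C, hC⟩ := hrisk
  have hlim : Tendsto (fun n => √C * √(Real.exp (2 * ((s n : ℝ) / √(n : ℝ))) - 1)) atTop
      (nhds 0) := by
    have h1 := h.tendsto_div_nhds_zero
    have h2 : Continuous fun t : ℝ => √(C : ℝ) * √(Real.exp (2 * t) - 1) := by fun_prop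
    have h3 := (h2.tendsto 0).comp h1
    simp only [mul_zero, Real.exp_zero, sub_self, Real.sqrt_zero] at h3
    exact h3
  filter_upwards [eventually_two_mul_le_sqrt h, hC,
    hlim.eventually_le_const (show (0 : ℝ) < 1 / 4 by norm_num)] with n hn hCn hsmall
  have hs1 : (1 : ℝ) ≤ s n := by exact_mod_cast hs n
  obtain ⟨h1, -, h3⟩ := log_one_add_sqrt_div_bounds (hs n) hn
  have hr : worstRisk n (s n) (T n) ≠ ∞ :=
    ne_top_of_le_ne_top (ENNReal.mul_ne_top ENNReal.coe_ne_top ENNReal.ofReal_ne_top) hCn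
  have key := mul_log_le_sqrt_worstSqBias_add (hs n) (by linarith) le_rfl (hT.1 n) hr
  have hb : worstSqBias n (s n) (T n) ≠ ∞ :=
    ne_top_of_le_ne_top hr (worstSqBias_le_worstRisk (hT.1 n))
  unfold sparseRate at hCn ⊢
  rw [← mul_pow] at hCn ⊢
  set R := (s n : ℝ) * Real.log ((n : ℝ) / (s n : ℝ) ^ 2) with hRdef
  have hR : 0 ≤ R := by positivity
  have hrR : √(worstRisk n (s n) (T n)).toReal ≤ √C * R := by
    have h4 := ENNReal.toReal_mono (ENNReal.mul_ne_top ENNReal.coe_ne_top ENNReal.ofReal_ne_top) hCn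
    rw [ENNReal.toReal_mul, ENNReal.toReal_ofReal (by positivity), ENNReal.coe_toReal] at h4
    calc _ ≤ √(C * R ^ 2) := Real.sqrt_le_sqrt h4
      _ = √C * R := by rw [Real.sqrt_mul (by positivity), Real.sqrt_sq hR]
  have h5 : √(worstRisk n (s n) (T n)).toReal * √(Real.exp (2 * ((s n : ℝ) / √(n : ℝ))) - 1) ≤
      1 / 4 * R := by
    calc _ ≤ √C * R * √(Real.exp (2 * ((s n : ℝ) / √(n : ℝ))) - 1) := by gcongr
      _ = √C * √(Real.exp (2 * ((s n : ℝ) / √(n : ℝ))) - 1) * R := by ring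
      _ ≤ _ := by gcongr
  have h6 : R / 2 ≤ s n * Real.log (1 + √(n : ℝ) / s n) := by
    rw [hRdef, mul_div_assoc]; gcongr
  have h7 : R ≤ 8 * √(worstSqBias n (s n) (T n)).toReal := by linarith
  calc ENNReal.ofReal (R ^ 2) ≤ ENNReal.ofReal (64 * (worstSqBias n (s n) (T n)).toReal) := by
        apply ENNReal.ofReal_le_ofReal
        calc R ^ 2 ≤ (8 * √(worstSqBias n (s n) (T n)).toReal) ^ 2 := pow_le_pow_left₀ hR h7 2
          _ = _ := by rw [mul_pow, Real.sq_sqrt ENNReal.toReal_nonneg]; norm_num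
    _ = _ := by rw [ENNReal.ofReal_mul (by norm_num), ENNReal.ofReal_toReal hb]; norm_num

lemma isLittleO_sqrt_of_le_rpow {δ : ℝ} (hδ : 0 < δ)
    (h : ∀ᶠ n : ℕ in atTop, (s n : ℝ) ≤ (n : ℝ) ^ (1 / 2 - δ)) :
    (fun n => (s n : ℝ)) =o[atTop] fun n => √(n : ℝ) := by
  have h1 : (fun n => (s n : ℝ)) =O[atTop] fun n : ℕ => (n : ℝ) ^ (1 / 2 - δ) := by
    refine IsBigO.of_bound 1 ?_
    filter_upwards [h] with n hn
    rw [Real.norm_of_nonneg (by positivity), Real.norm_of_nonneg (by positivity), one_mul]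
    exact hn
  have h2 : (fun x : ℝ => x ^ (1 / 2 - δ)) =o[atTop] fun x : ℝ => x ^ (1 / 2 : ℝ) := by
    refine isLittleO_of_tendsto' ?_ ?_
    · filter_upwards [eventually_gt_atTop 0] with x hx h0
      exact absurd h0 (Real.rpow_pos_of_pos hx _).ne'
    · refine (tendsto_rpow_neg_atTop hδ).congr' ?_
      filter_upwards [eventually_gt_atTop 0] with x hx
      rw [← Real.rpow_sub hx]
      congr 1; ring
  simp only [Real.sqrt_eq_rpow]
  exact h1.trans_isLittleO (h2.comp_tendsto tendsto_natCast_atTop_atTop)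

end Sparse

section Dense

variable {s : ℕ → ℕ}

lemma worstRisk_unbiasedEstimator_orderLE (hs : ∀ n, 1 ≤ s n) :
    OrderLE (fun n => worstRisk n (s n) (unbiasedEstimator n))
      fun n => ENNReal.ofReal (n : ℝ) := by
  have hK := fourthMoment_nonneg
  refine OrderLE.of_ofReal (2 * fourthMoment + 16) (by positivity) ?_
  filter_upwards [eventually_ge_atTop 1] with n hn
  refine iSup₂_le fun θ hθ => (mse_unbiasedEstimator_le θ).trans (ENNReal.ofReal_le_ofReal ?_)
  have hs0 : (0 : ℝ) < s n := by exact_mod_cast hs n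
  have hn1 : (1 : ℝ) ≤ n := by exact_mod_cast hn
  have h1 : Real.log (1 + √(n : ℝ) / s n) ≤ √(n : ℝ) / s n := by
    have : 0 ≤ √(n : ℝ) / s n := by positivity
    linarith [Real.log_le_sub_one_of_pos (show 0 < 1 + √(n : ℝ) / s n by linarith)]
  have h2 : sqNorm θ ≤ 2 * √(n : ℝ) := by
    refine hθ.2.trans ?_
    calc 2 * (s n : ℝ) * Real.log (1 + √(n : ℝ) / s n) ≤ 2 * (s n : ℝ) * (√(n : ℝ) / s n) := by
          gcongr
      _ = _ := by field_simp
  have h3 : √(n : ℝ) ≤ n := Real.sqrt_le_iff.2 ⟨by linarith, by nlinarith⟩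
  linarith

/-- The minimax lower bound in the dense regime. -/
theorem orderLE_minimaxMSE_of_sqrt_isBigO (hs : ∀ n, 1 ≤ s n)
    (h : (fun n : ℕ => √(n : ℝ)) =O[atTop] fun n => (s n : ℝ)) :
    OrderLE (fun n => ENNReal.ofReal (n : ℝ)) fun n => minimaxMSE n (s n) := by
  obtain ⟨C, hC1, hC⟩ := h.exists_pos
  have hC0 : 0 ≤ C + 2 := by linarith
  refine ⟨⟨4 * (C + 2) ^ 2, by positivity⟩ * 36, ?_⟩
  filter_upwards [hC.bound, eventually_ge_atTop 4] with n hn hn4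
  rw [Real.norm_of_nonneg (by positivity), Real.norm_of_nonneg (by positivity)] at hn
  have hn2 : (2 : ℝ) ≤ √(n : ℝ) := Real.le_sqrt_of_sq_le (by norm_num; exact_mod_cast hn4)
  set q := min (s n) (Nat.sqrt n) with hq
  have hq1 : 1 ≤ q := le_min (hs n) (Nat.sqrt_pos.2 (by omega))
  have hqn : (q : ℝ) ≤ √(n : ℝ) :=
    le_trans (by exact_mod_cast min_le_right _ _) Real.nat_sqrt_le_real_sqrt
  have hqC : √(n : ℝ) ≤ (C + 2) * q := by
    have hs0 : (0 : ℝ) ≤ s n := Nat.cast_nonneg _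
    rcases min_choice (s n) (Nat.sqrt n) with h' | h' <;> rw [hq, h']
    · linarith
    · have h1 := Real.real_sqrt_le_nat_sqrt_succ (a := n)
      nlinarith
  have key := ofReal_sq_mul_log_le_minimaxMSE hq1 hqn (min_le_left (s n) (Nat.sqrt n))
  have hq0 : (0 : ℝ) < q := by exact_mod_cast hq1
  have hlog : 1 / 2 ≤ Real.log (1 + √(n : ℝ) / q) := by
    have h1 : 1 ≤ √(n : ℝ) / q := (one_le_div hq0).2 hqn
    linarith [Real.log_two_gt_d9, Real.log_le_log (by norm_num : (0 : ℝ) < 2)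
      (by linarith : 2 ≤ 1 + √(n : ℝ) / q)]
  have h2 : √(n : ℝ) ≤ (C + 2) * (2 * (q * Real.log (1 + √(n : ℝ) / q))) := by
    refine hqC.trans (mul_le_mul_of_nonneg_left ?_ hC0)
    nlinarith
  have h3 : (n : ℝ) ≤ 4 * (C + 2) ^ 2 * (q * Real.log (1 + √(n : ℝ) / q)) ^ 2 := by
    calc (n : ℝ) = √(n : ℝ) ^ 2 := (Real.sq_sqrt (Nat.cast_nonneg n)).symm
      _ ≤ ((C + 2) * (2 * (q * Real.log (1 + √(n : ℝ) / q)))) ^ 2 :=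
        pow_le_pow_left₀ (by positivity) h2 2
      _ = _ := by ring
  have hD : (0 : ℝ) ≤ 4 * (C + 2) ^ 2 := by positivity
  calc ENNReal.ofReal (n : ℝ) ≤ ENNReal.ofReal (4 * (C + 2) ^ 2) *
        ENNReal.ofReal ((q * Real.log (1 + √(n : ℝ) / q)) ^ 2) := by
        rw [← ENNReal.ofReal_mul hD]; exact ENNReal.ofReal_le_ofReal h3
    _ ≤ ENNReal.ofReal (4 * (C + 2) ^ 2) * (36 * minimaxMSE n (s n)) := by gcongr
    _ = _ := by rw [ENNReal.ofReal_eq_coe_nnreal hD, ← mul_assoc]; rfl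

lemma isRateOptimal_unbiasedEstimator (hs : ∀ n, 1 ≤ s n)
    (h : (fun n : ℕ => √(n : ℝ)) =O[atTop] fun n => (s n : ℝ)) :
    IsRateOptimal s unbiasedEstimator :=
  ⟨measurable_unbiasedEstimator,
    (worstRisk_unbiasedEstimator_orderLE hs).trans (orderLE_minimaxMSE_of_sqrt_isBigO hs h)⟩

end Dense

end GaussSeq

theorem theorem6p2 (s : ℕ → ℕ) (hs : ∀ n, 1 ≤ s n) :
    -- `s ≪ √n`: the minimax rate, and the bias of every rate-optimal estimator
    (((fun n => (s n : ℝ)) =o[atTop] fun n => √(n : ℝ)) →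
      SameOrder (fun n => minimaxMSE n (s n)) (sparseRate s) ∧
      ∀ T : (n : ℕ) → (Fin n → ℝ) → ℝ, IsRateOptimal s T →
        SameOrder (fun n => worstSqBias n (s n) (T n)) (sparseRate s)) ∧
    -- `s ≤ n ^ (1/2 - δ)`: a rate-optimal estimator of small variance
    (∀ δ : ℝ, 0 < δ → δ < 1 / 2 → (∀ᶠ n : ℕ in atTop, (s n : ℝ) ≤ (n : ℝ) ^ (1 / 2 - δ)) →
      ∃ T : (n : ℕ) → (Fin n → ℝ) → ℝ, IsRateOptimal s T ∧
        OrderLE (fun n => worstVariance n (s n) (T n))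
          (fun n => ENNReal.ofReal ((s n : ℝ) * Real.log ((n : ℝ) / (s n : ℝ) ^ 2)))) ∧
    -- `s ≳ √n`: an unbiased rate-optimal estimator
    (((fun n : ℕ => √(n : ℝ)) =O[atTop] fun n => (s n : ℝ)) →
      ∃ T : (n : ℕ) → (Fin n → ℝ) → ℝ, IsRateOptimal s T ∧
        ∀ n, IsUnbiased n (s n) (T n)) := by
  refine ⟨fun h => ⟨sameOrder_minimaxMSE_sparseRate hs h, fun T hT =>
    sameOrder_worstSqBias_sparseRate hs h hT⟩, fun δ hδ _ h => ?_, fun h => ?_⟩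
  · have h' := isLittleO_sqrt_of_le_rpow hδ h
    exact ⟨softEstimator, isRateOptimal_softEstimator hs h',
      worstVariance_softEstimator_orderLE hs h'⟩
  · exact ⟨unbiasedEstimator, isRateOptimal_unbiasedEstimator hs h,
      fun n => isUnbiased_unbiasedEstimator n (s n)⟩
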